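/- Let $q\ge 2$ and let $T$ be a $(q+1)$-regular tree in which every vertex has one predecessor and $q$ successors, the edges from each vertex to its successors being labelled bijectively by $\{0,\dots,q-1\}$. Fix a base vertex $o$ such that no edge on the descending ray from $o$ has label $1$. For a vertex $v$ let $o\curlywedge v$ be the greatest common ancestor of $o$ and $v$, and set $l(v)=d_T(v,o\curlywedge v)$, $m(v)=d_T(o,o\curlywedge v)$, $h(v)=l(v)-m(v)$. Let $T_1,T_2,T_3$ be copies of $T$ (with base points $o_i$ and functions $m_i,l_i,h_i$), and let $DL_3(q)$ be the graph whose vertices are the triples $v=(v_1,v_2,v_3)$, $v_i\in T_i$, with $h_1(v_1)+h_2(v_2)+h_3(v_3)=0$; two vertices $v,w$ are adjacent if there are $i\ne j$ such that $v_i,w_i$ are adjacent in $T_i$, $v_j,w_j$ are adjacent in $T_j$, and $v_k=w_k$ for $k\notin\{i,j\}$. Put $id=(o_1,o_2,o_3)$, let $d$ be the graph distance of $DL_3(q)$, and regard $DL_3(q)$ as its (discrete) vertex set. The map $x\mapsto \big(z\mapsto d(x,z)-d(x,id)\big)$ embeds $DL_3(q)$ in the space of functions $f:DL_3(q)\to\mathbb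 R$ with $f(id)=0$, with the compact-open topology; the closure of the image is the horofunction compactification $\overline{DL_3(q)}$, and $\partial DL_3(q)=\overline{DL_3(q)}\setminus DL_3(q)$. For $k\ge1$ and $i\in\{1,2,3\}$ let $\zeta^i_k$ be the vertex whose $i$-th coordinate is reached from $o_i$ by going down $k$ edges and then up $k$ edges labelled $1$, the other coordinates being the base points. For $j\in\{1,2\}$ and $\epsilon\in\{0,\dots,q-1\}$ let $\nu^{j,\epsilon}_1$ be the vertex obtained from $id$ by going up the edge labelled $\epsilon$ in $T_j$ and down one edge in $T_3$. Put $\beta_0=id$ and $\beta_n=\zeta^3_n$ for $n\ge1$, and $$F_0=\{\zeta^1_1,\ \zeta^2_1,\ \nu^{1,0}_1,\ \nu^{1,1}_1,\ \nu^{2,0}_1,\ \nu^{2,1}_1\}.$$ **Theorem.** The sequence $(\beta_n)$ defines a horofunction $\beta\in\partial DL_3(q)$, $\beta(z)=\lim_{n\to\infty}\big(d(\beta_n,z)-d(\beta_n,id)\big)$, and: 1. a sequence $(b_n)$ in $DL_3(q)$ converges to $\beta$ in $\overline{DL_3(q)}$ if and only if it has a tail whose projections to $T_1$ and $T_2$ are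 trivial (equal to $o_1$ and $o_2$) and $m_3(b_n)\to\infty$; 2. for every vertex $x$ of $DL_3(q)$ whose projection to $T_1$ or to $T_2$ is nontrivial there is $f\in F_0$ with $d(x,f)-d(x,id)\ne\beta(f)$. -/

import Mathlib

open Filter Topology

universe u

/-- A `(q+1)`-valent tree in which every vertex has one predecessor and `q` successors, the edges
to the successors of each vertex being labelled bijectively by `{0, …, q-1}`, with a base vertex
`o`.  Here `child v e` is the successor of `v` reached along the edge labelled `e`. -/
structure LabeledTree (q : ℕ) [q.AtLeastTwo] where
  V : Type u
  graph : SimpleGraph V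
  isTree : graph.IsTree
  pred : V → V
  adj_iff : ∀ v w, graph.Adj v w ↔ pred v = w ∨ pred w = v
  /-- The predecessor of a vertex is not one of its successors (so the valency is `q + 1`). -/
  pred_pred_ne : ∀ v, pred (pred v) ≠ v
  child : V → Fin q → V
  pred_child : ∀ v e, pred (child v e) = v
  child_injective : ∀ v, Function.Injective (child v)
  exists_child : ∀ w, ∃ e, child (pred w) e = w
  o : V
  /-- No edge on the descending ray from `o` is labelled `1`: an upward path of edges labelled `1`
  that starts on this ray never backtracks along it. -/
  ray_label : ∀ n : ℕ, child (pred^[n + 1] o) 1 ≠ pred^[n] o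

namespace LabeledTree

variable {q : ℕ} [q.AtLeastTwo] (T : LabeledTree.{u} q)

/-- The greatest common ancestor `v ⋏ w`: the first vertex on the descending ray from `v` that is
also an ancestor of `w`. -/
noncomputable def meet (v w : T.V) : T.V :=
  T.pred^[sInf {n : ℕ | ∃ k : ℕ, T.pred^[n] v = T.pred^[k] w}] v

/-- `l(v) = d(v, o ⋏ v)`. -/
noncomputable def l (v : T.V) : ℕ := T.graph.dist v (T.meet T.o v)

/-- `m(v) = d(o, o ⋏ v)`. -/
noncomputable def m (v : T.V) : ℕ := T.graph.dist T.o (T.meet T.o v)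

/-- The height `h(v) = l(v) - m(v)`. -/
noncomputable def height (v : T.V) : ℤ := (T.l v : ℤ) - (T.m v : ℤ)

/-- The end point of the path that starts at `v` and goes up `n` edges, all labelled `e`. -/
def climb (e : Fin q) (n : ℕ) (v : T.V) : T.V := (fun w => T.child w e)^[n] v

/-- The descending walk of `n` steps from `v`. -/
def downWalk : (n : ℕ) → (v : T.V) → T.graph.Walk v (T.pred^[n] v)
  | 0, _ => SimpleGraph.Walk.nil
  | n + 1, v => SimpleGraph.Walk.cons ((T.adj_iff v (T.pred v)).2 (Or.inl rfl))
      (downWalk n (T.pred v))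

theorem length_downWalk (n : ℕ) (v : T.V) : (T.downWalk n v).length = n := by
  induction n generalizing v with
  | zero => rfl
  | succ n ih => exact congrArg (· + 1) (ih (T.pred v))

theorem isPath_downWalk (n : ℕ) (v : T.V) : (T.downWalk n v).IsPath := by
  rw [T.isTree.isAcyclic.isPath_iff_isChain]
  induction n generalizing v with
  | zero => simp [downWalk]
  | succ n ih =>
    cases n with
    | zero => simp [downWalk]
    | succ n =>
      have h := ih (T.pred v)
      simp only [downWalk] at h ⊢
      refine List.IsChain.cons_cons ?_ h
      intro hs
      change s(v, T.pred v) = s(T.pred v, T.pred (T.pred v)) at hs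
      rw [Sym2.eq_iff] at hs
      rcases hs with ⟨h1, h2⟩ | ⟨h1, h2⟩
      · exact T.pred_pred_ne v (by rw [← h2, ← h1])
      · exact T.pred_pred_ne v h1.symm

theorem dist_iterate_pred (n : ℕ) (v : T.V) : T.graph.dist v (T.pred^[n] v) = n := by
  obtain ⟨p, hp, hl⟩ := T.isTree.connected.exists_path_of_dist v (T.pred^[n] v)
  have := (T.isTree.isAcyclic.subsingleton_path _ _).elim ⟨p, hp⟩ ⟨_, T.isPath_downWalk n v⟩
  have h2 : p = T.downWalk n v := congrArg Subtype.val this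
  rw [← hl, h2, length_downWalk]

theorem exists_common (v w : T.V) : ∃ n k : ℕ, T.pred^[n] v = T.pred^[k] w := by
  obtain ⟨p⟩ := T.isTree.connected.preconnected v w
  induction p with
  | nil => exact ⟨0, 0, rfl⟩
  | @cons a b c hab p ih =>
    obtain ⟨n, k, h⟩ := ih
    rcases (T.adj_iff a b).1 hab with h1 | h1
    · exact ⟨n + 1, k, by rw [Function.iterate_succ_apply, h1, h]⟩
    · refine ⟨n, k + 1, ?_⟩
      rw [Function.iterate_succ_apply' T.pred k c, ← h, ← Function.iterate_succ_apply' T.pred n b,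
        Function.iterate_succ_apply, h1]

/-- The height of `v` is read off from any common ancestor of `o` and `v`. -/
theorem height_eq {n k : ℕ} {v : T.V} (h : T.pred^[n] T.o = T.pred^[k] v) :
    T.height v = (k : ℤ) - n := by
  have hne : {n : ℕ | ∃ k : ℕ, T.pred^[n] T.o = T.pred^[k] v}.Nonempty := ⟨n, k, h⟩
  obtain ⟨k0, hk0⟩ := Nat.sInf_mem hne
  have hle := Nat.sInf_le (show n ∈ {n : ℕ | ∃ k : ℕ, T.pred^[n] T.o = T.pred^[k] v} from ⟨k, h⟩)
  have hm : T.m v = sInf {n : ℕ | ∃ k : ℕ, T.pred^[n] T.o = T.pred^[k] v} := by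
    rw [m, meet, dist_iterate_pred]
  have hl : T.l v = k0 := by rw [l, meet, hk0, dist_iterate_pred]
  rw [height, hm, hl]
  set N := sInf {n : ℕ | ∃ k : ℕ, T.pred^[n] T.o = T.pred^[k] v}
  have hk : T.pred^[k] v = T.pred^[n - N + k0] v := by
    rw [Function.iterate_add_apply, ← hk0, ← Function.iterate_add_apply, ← h]
    congr 2
    omega
  have := T.dist_iterate_pred k v
  rw [hk, dist_iterate_pred] at this
  omega

theorem iterate_pred_climb (e : Fin q) (n : ℕ) (v : T.V) : T.pred^[n] (T.climb e n v) = v := by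
  induction n with
  | zero => rfl
  | succ n ih =>
    rw [climb, Function.iterate_succ_apply, Function.iterate_succ_apply', T.pred_child]
    exact ih

theorem height_o : T.height T.o = 0 := by
  rw [T.height_eq (n := 0) (k := 0) rfl]; rfl

theorem height_iterate_pred (n : ℕ) : T.height (T.pred^[n] T.o) = -n := by
  rw [T.height_eq (n := n) (k := 0) rfl]; simp

theorem height_climb_o (e : Fin q) (n : ℕ) : T.height (T.climb e n T.o) = n := by
  rw [T.height_eq (n := 0) (k := n) (T.iterate_pred_climb e n T.o).symm]; simp

theorem height_climb_pred (e : Fin q) (n : ℕ) :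
    T.height (T.climb e n (T.pred^[n] T.o)) = 0 := by
  rw [T.height_eq (n := n) (k := n) (T.iterate_pred_climb e n _).symm]; simp

end LabeledTree

namespace LabeledTree

/-- A graph of a predecessor map is acyclic if the predecessor map lowers some height. -/
theorem isAcyclic_of_height {V : Type u} (G : SimpleGraph V) (p : V → V) (ht : V → ℤ)
    (hp : ∀ v, ht (p v) = ht v - 1) (hG : ∀ v w, G.Adj v w ↔ p v = w ∨ p w = v) :
    G.IsAcyclic := by
  classical
  intro a c hc
  obtain ⟨x, hx, hmax⟩ := c.support.toFinset.exists_max_image ht ⟨a, by simp⟩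
  rw [List.mem_toFinset] at hx
  have hc2 : (c.rotate x hx).IsCycle := SimpleGraph.Walk.IsCycle.rotate hx hc
  have key : ∀ y, G.Adj x y → y ∈ (c.rotate x hx).support → y = p x := by
    intro y hxy hy
    rcases (hG x y).1 hxy with h | h
    · exact h.symm
    · have hy' : y ∈ c.support := by
        exact (SimpleGraph.Walk.mem_support_rotate_iff _ _ hx).1 hy
      have h1 := hmax y (List.mem_toFinset.2 hy')
      have h2 := hp y
      rw [h] at h2
      omega
  apply hc2.snd_ne_penultimate
  rw [key _ (SimpleGraph.Walk.adj_snd hc2.not_nil) (SimpleGraph.Walk.getVert_mem_support _ _),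
    key _ (SimpleGraph.Walk.adj_penultimate hc2.not_nil).symm
      (SimpleGraph.Walk.getVert_mem_support _ _)]

/-- Vertices of the standard model: a height `h` and the labels of the edges of the descending ray,
indexed by their upper heights; these are eventually `0`. -/
def StdVertex (q : ℕ) [q.AtLeastTwo] : Type :=
  {x : ℤ × (ℤ → Fin q) // (∀ k, x.1 < k → x.2 k = 0) ∧ ∃ N, ∀ k ≤ N, x.2 k = 0}

variable {q : ℕ} [q.AtLeastTwo]

def stdPred (x : StdVertex q) : StdVertex q :=
  ⟨(x.1.1 - 1, Function.update x.1.2 x.1.1 0), by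
    obtain ⟨⟨h, a⟩, h1, N, hN⟩ := x
    refine ⟨fun k hk => ?_, N, fun k hk => ?_⟩
    · by_cases hkh : k = h
      · simp [hkh]
      · simpa [hkh] using h1 k (by simp at hk ⊢; omega)
    · by_cases hkh : k = h
      · simp [hkh]
      · simpa [hkh] using hN k hk⟩

def stdChild (x : StdVertex q) (e : Fin q) : StdVertex q :=
  ⟨(x.1.1 + 1, Function.update x.1.2 (x.1.1 + 1) e), by
    obtain ⟨⟨h, a⟩, h1, N, hN⟩ := x
    refine ⟨fun k hk => ?_, min N h, fun k hk => ?_⟩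
    · have hkh : k ≠ h + 1 := by simp at hk; omega
      simpa [hkh] using h1 k (by simp at hk ⊢; omega)
    · have hkh : k ≠ h + 1 := by simp at hk; omega
      simpa [hkh] using hN k (by simp at hk; omega)⟩

def stdO : StdVertex q := ⟨(0, fun _ => 0), fun _ _ => rfl, 0, fun _ _ => rfl⟩

theorem stdPred_child (x : StdVertex q) (e : Fin q) : stdPred (stdChild x e) = x := by
  obtain ⟨⟨h, a⟩, h1, N, hN⟩ := x
  apply Subtype.ext
  refine Prod.ext (by simp [stdPred, stdChild]) ?_
  have : (0 : Fin q) = a (h + 1) := (h1 (h + 1) (by simp)).symm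
  simp [stdPred, stdChild, this]

theorem stdPred_iterate (n : ℕ) (x : StdVertex q) :
    (stdPred^[n] x).1.1 = x.1.1 - n ∧
    ∀ k, (stdPred^[n] x).1.2 k = if k ≤ x.1.1 - n then x.1.2 k else 0 := by
  induction n with
  | zero =>
    refine ⟨by simp, fun k => ?_⟩
    split_ifs with h
    · rfl
    · exact x.2.1 k (by simpa using h)
  | succ n ih =>
    rw [Function.iterate_succ_apply']
    refine ⟨by simp only [stdPred, ih.1]; push_cast; ring, fun k => ?_⟩
    simp only [stdPred, Function.update_apply, ih.1, ih.2]
    push_cast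
    split_ifs <;> first | rfl | omega

def stdGraph (q : ℕ) [q.AtLeastTwo] : SimpleGraph (StdVertex q) where
  Adj v w := stdPred v = w ∨ stdPred w = v
  symm := ⟨fun _ _ h => h.symm⟩
  loopless := ⟨fun v h => by
    have : (stdPred v).1.1 = v.1.1 := by rw [h.elim id id]
    simp [stdPred] at this⟩

theorem stdGraph_isTree : (stdGraph q).IsTree := by
  have hreach : ∀ (n : ℕ) (v : StdVertex q), (stdGraph q).Reachable v (stdPred^[n] v) := by
    intro n
    induction n with
    | zero => exact fun v => SimpleGraph.Reachable.refl v
    | succ n ih =>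
      intro v
      have h : (stdGraph q).Adj v (stdPred v) := Or.inl rfl
      exact h.reachable.trans (ih (stdPred v))
  have hO : ∀ v : StdVertex q, (stdGraph q).Reachable v stdO := by
    intro v
    obtain ⟨N, hN⟩ := v.2.2
    have hM1 : min (min N 0) v.1.1 ≤ N := by omega
    have hM2 : min (min N 0) v.1.1 ≤ 0 := by omega
    have hM3 : min (min N 0) v.1.1 ≤ v.1.1 := by omega
    generalize min (min N 0) v.1.1 = M at hM1 hM2 hM3
    have he : stdPred^[(v.1.1 - M).toNat] v = stdPred^[(-M).toNat] stdO := by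
      have h1 := stdPred_iterate (v.1.1 - M).toNat v
      have h2 := stdPred_iterate (-M).toNat (stdO : StdVertex q)
      apply Subtype.ext
      refine Prod.ext ?_ (funext fun k => ?_)
      · rw [h1.1, h2.1]; simp only [stdO]; omega
      · rw [h1.2, h2.2]
        have hz : (stdO : StdVertex q).1.2 k = 0 := rfl
        rw [hz, ite_self]
        split_ifs with h
        · exact hN k (by omega)
        · rfl
    exact (hreach _ v).trans (he ▸ (hreach _ stdO).symm)
  have : Nonempty (StdVertex q) := ⟨stdO⟩
  exact ⟨⟨fun v w => (hO v).trans (hO w).symm⟩,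
    isAcyclic_of_height _ stdPred (fun v => v.1.1) (fun _ => rfl) fun _ _ => Iff.rfl⟩

/-- The standard model of the labelled tree; every edge of the descending ray from `o` has
label `0`. -/
def std (q : ℕ) [q.AtLeastTwo] : LabeledTree q where
  V := StdVertex q
  graph := stdGraph q
  isTree := stdGraph_isTree
  pred := stdPred
  adj_iff _ _ := Iff.rfl
  pred_pred_ne v h := by
    have := congrArg (fun x => x.1.1) h
    simp only [stdPred] at this
    omega
  child := stdChild
  pred_child := stdPred_child
  child_injective v e e' h := by
    have := congrArg (fun x => x.1.2 (v.1.1 + 1)) h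
    simpa [stdChild] using this
  exists_child w := by
    refine ⟨w.1.2 w.1.1, Subtype.ext (Prod.ext ?_ ?_)⟩
    · simp [stdChild, stdPred]
    · simp [stdChild, stdPred]
  o := stdO
  ray_label n h := by
    have h1 := (stdPred_iterate (n + 1) (stdO : StdVertex q)).1
    have h2 := (stdPred_iterate n (stdO : StdVertex q)).2 (-n)
    rw [← h] at h2
    have hn : (stdPred^[n + 1] (stdO : StdVertex q)).1.1 + 1 = -(n : ℤ) := by
      rw [h1]; simp only [stdO]; push_cast; ring
    have h10 : (1 : Fin q) ≠ 0 := by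
      have := Nat.AtLeastTwo.prop (n := q)
      rw [Ne, Fin.ext_iff, Fin.val_one', Fin.val_zero, Nat.mod_eq_of_lt (by omega)]
      exact one_ne_zero
    apply h10
    have hz : (stdO : StdVertex q).1.2 (-n) = 0 := rfl
    rw [hz, ite_self] at h2
    rw [← h2]
    generalize stdPred^[n + 1] (stdO : StdVertex q) = y at hn
    simp [stdChild, ← hn]

end LabeledTree

/-- The vertex set of the Diestel-Leader graph `DL_d(q)`. -/
def DL {q : ℕ} [q.AtLeastTwo] (T : LabeledTree.{u} q) (d : ℕ) : Type u :=
  {v : Fin d → T.V // ∑ i, T.height (v i) = 0}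

namespace DL

variable {q : ℕ} [q.AtLeastTwo] (T : LabeledTree.{u} q)

/-- The projection to the `i`-th tree. -/
def proj {T : LabeledTree.{u} q} {d : ℕ} (i : Fin d) (v : DL T d) : T.V := v.1 i

/-- The Diestel-Leader graph `DL_d(q)`. -/
def graph (d : ℕ) : SimpleGraph (DL T d) where
  Adj v w := ∃ i j : Fin d, i ≠ j ∧ T.graph.Adj (proj i v) (proj i w) ∧
    T.graph.Adj (proj j v) (proj j w) ∧ ∀ k, k ≠ i → k ≠ j → proj k v = proj k w
  symm := ⟨fun _ _ ⟨i, j, hij, hi, hj, hk⟩ =>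
    ⟨i, j, hij, hi.symm, hj.symm, fun k h1 h2 => (hk k h1 h2).symm⟩⟩
  loopless := ⟨fun _ ⟨_, _, _, hi, _⟩ => hi.ne rfl⟩

/-- The base point `id = (o, …, o)`. -/
def id (d : ℕ) : DL T d := ⟨fun _ => T.o, by simp [T.height_o]⟩

/-- The vertex set is discrete (the graph distance takes integer values). -/
instance (d : ℕ) : TopologicalSpace (DL T d) := ⊥

instance (d : ℕ) : DiscreteTopology (DL T d) := ⟨rfl⟩

/-- `ζ^i_k`: all coordinates are `o` except the `i`-th, which is reached from `o` by going down `k`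
edges and then up `k` edges labelled `1`. -/
def zeta (i : Fin 3) (k : ℕ) : DL T 3 :=
  ⟨fun j => if j = i then T.climb 1 k (T.pred^[k] T.o) else T.o, by
    refine Finset.sum_eq_zero fun j _ => ?_
    dsimp only
    split_ifs
    · exact T.height_climb_pred 1 k
    · exact T.height_o⟩

/-- `ν^{j,ε}_k` with `j` one of the first two trees: go up `k` edges labelled `ε` in tree `j` and
down `k` edges in the third tree. -/
def nu (j : Fin 2) (ε : Fin q) (k : ℕ) : DL T 3 :=
  ⟨fun i => if i = j.castSucc then T.climb ε k T.o
    else if i = 2 then T.pred^[k] T.o else T.o, by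
    fin_cases j <;>
      simp [Fin.sum_univ_three, T.height_climb_o, T.height_iterate_pred, T.height_o]⟩

/-- The sequence `β_n`: trivial in the first two trees; in the third tree go down `n` edges from `o`
and then up `n` edges labelled `1`. -/
def betaSeq (n : ℕ) : DL T 3 := zeta T 2 n

/-- The finite set `F₀ = {ζ^1_1, ζ^2_1, ν^{1,0}_1, ν^{1,1}_1, ν^{2,0}_1, ν^{2,1}_1}`
(the trees are indexed by `0, 1, 2` here). -/
def testPoints : Set (DL T 3) :=
  {zeta T 0 1, zeta T 1 1, nu T 0 0 1, nu T 0 1 1, nu T 1 0 1, nu T 1 1 1}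

end DL

/-! ### Horofunctions of a based graph -/

section Horofunction

variable {X : Type u} [TopologicalSpace X] [DiscreteTopology X]

/-- The space `C₀(X)` of continuous functions `X → ℝ` vanishing at `x₀`, with the compact-open
topology. -/
abbrev BasedMap (x₀ : X) : Type u := {f : C(X, ℝ) // f x₀ = 0}

variable (G : SimpleGraph X) (x₀ : X)

/-- The map `x ↦ (z ↦ d(x,z) - d(x,x₀))` from `X` to `C₀(X)`. -/
noncomputable def horoMap (x : X) : BasedMap x₀ :=
  ⟨⟨fun z => (G.dist x z : ℝ) - (G.dist x x₀ : ℝ), continuous_of_discreteTopology⟩, sub_self _⟩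

/-- The horofunction compactification: the closure of `X` in `C₀(X)`. -/
abbrev HoroCompactification : Type u := ↥(closure (Set.range (horoMap G x₀)))

/-- A vertex as a point of the horofunction compactification. -/
noncomputable def horoEmbed (x : X) : HoroCompactification G x₀ :=
  ⟨horoMap G x₀ x, subset_closure (Set.mem_range_self x)⟩

/-- The horofunction boundary: the points of the compactification that are not vertices. -/
def horoBoundary : Set (HoroCompactification G x₀) := (Set.range (horoEmbed G x₀))ᶜ

variable {G x₀}

/-- The value at `z` of the function that a point of the compactification is. -/
def HoroCompactification.eval (f : HoroCompactification G x₀) (z : X) : ℝ := f.1.1 z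

/-- `f` is the horofunction defined by the sequence `x`: `f(z) = lim d(x_n,z) - d(x_n,x₀)`. -/
def IsHorofunctionOf (f : HoroCompactification G x₀) (x : ℕ → X) : Prop :=
  f ∈ horoBoundary G x₀ ∧
    ∀ z, Tendsto (fun n => (G.dist (x n) z : ℝ) - (G.dist (x n) x₀ : ℝ)) atTop (𝓝 (f.eval z))

end Horofunction

/-! ### Common ancestors in a labelled tree -/

namespace LabeledTree

variable {q : ℕ} [q.AtLeastTwo] (T : LabeledTree.{u} q)

/-! Distances in the graph reduce to a problem about height vectors. A path projects to a walk of
integer vectors of sum zero, each step raising one height and lowering another. In every tree the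
projection must reach a common ancestor of its two end points. Conversely, a height walk that is low
enough at some time in each coordinate lifts to a path (`IsAdmissible.exists_walk`). So a distance
depends only on the heights of the end points and on which heights carry common ancestors
(`dist_le_of_commonAt`).

Convergence: a path from `ζ^3_n` to `z` with `n > m_3(z)` descends to depth `n` in `T_3`. Inserting
one extra step down and back there turns it into a path from `ζ^3_{n+1}`. Hence `d(ζ^3_n, z) - 2n`
is eventually nonincreasing. It is an integer bounded below by the triangle inequality, so it is
eventually constant, and `2n = d(ζ^3_n, id)`. Vertices with trivial first two projections behave
towards distant `z` like `ζ^3_m` of the same depth, which gives the "if" half of the criterion.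

Separation: `β ≥ 1` at `ζ^1_1`, `ζ^2_1`, because descending in a second tree costs a step beyond the
`2n` forced by `T_3`. And `β < 0` at each `ν^{j,ε}_1`, which is one step closer than `id`. Let `x`
have a nontrivial projection to `T_1` or `T_2`. If `m_1(x)` or `m_2(x)` is positive, the matching
`ζ` is no farther from `x` than `id`. Otherwise some `h_j(x) > 0` with `j ≤ 2`, and one of the
labels `0`, `1` starts a branch of `T_j` avoiding `x_j`; the corresponding `ν` is at least as far
from `x` as `id`. Either way the sign contradicts `β`. Since the test set is finite, convergence to
`β` forces trivial projections on a tail, and the values `β(ζ^3_k) ≤ 0` then force `m_3 → ∞`. -/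

theorem height_pred (v : T.V) : T.height (T.pred v) = T.height v - 1 := by
  obtain ⟨n, k, h⟩ := T.exists_common T.o v
  have h2 : T.pred^[n + 1] T.o = T.pred^[k] (T.pred v) := by
    rw [Function.iterate_succ_apply', h, ← Function.iterate_succ_apply' T.pred,
      Function.iterate_succ_apply]
  rw [T.height_eq h, T.height_eq h2]
  push_cast
  ring

theorem height_pred_iterate (n : ℕ) (v : T.V) : T.height (T.pred^[n] v) = T.height v - n := by
  induction n with
  | zero => simp
  | succ n ih =>
    rw [Function.iterate_succ_apply', height_pred, ih]
    push_cast
    ring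

theorem height_climb (e : Fin q) (n : ℕ) (v : T.V) : T.height (T.climb e n v) = T.height v + n := by
  have h := T.height_pred_iterate n (T.climb e n v)
  rw [iterate_pred_climb] at h
  omega

theorem climb_succ (e : Fin q) (n : ℕ) (v : T.V) :
    T.climb e (n + 1) v = T.child (T.climb e n v) e :=
  Function.iterate_succ_apply' _ _ _

theorem height_sub_of_adj {v w : T.V} (h : T.graph.Adj v w) :
    T.height w = T.height v + 1 ∨ T.height w = T.height v - 1 := by
  rcases (T.adj_iff v w).1 h with rfl | rfl <;> simp [height_pred]

/-- `v` and `w` have a common ancestor of height `s`. -/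
def CommonAt (v w : T.V) (s : ℤ) : Prop :=
  ∃ n k : ℕ, T.pred^[n] v = T.pred^[k] w ∧ T.height v - n = s

variable {T}

namespace CommonAt

variable {v w z : T.V} {s t : ℤ}

theorem symm (h : T.CommonAt v w s) : T.CommonAt w v s := by
  obtain ⟨n, k, e, hs⟩ := h
  refine ⟨k, n, e.symm, ?_⟩
  rw [← height_pred_iterate, ← e, height_pred_iterate, hs]

theorem le_left (h : T.CommonAt v w s) : s ≤ T.height v := by
  obtain ⟨n, k, e, hs⟩ := h
  omega

theorem le_right (h : T.CommonAt v w s) : s ≤ T.height w := h.symm.le_left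

theorem mono (h : T.CommonAt v w s) (hts : t ≤ s) : T.CommonAt v w t := by
  obtain ⟨n, k, e, hs⟩ := h
  refine ⟨(s - t).toNat + n, (s - t).toNat + k, ?_, by push_cast; omega⟩
  rw [Function.iterate_add_apply, e, ← Function.iterate_add_apply]

/-- A vertex has only one ancestor of a given height, so both common ancestors are the ancestor of
`w` at height `s`. -/
theorem trans (h : T.CommonAt v w s) (h' : T.CommonAt w z s) : T.CommonAt v z s := by
  obtain ⟨k, n, e, hs⟩ := h.symm
  obtain ⟨k', n', e', hs'⟩ := h'
  obtain rfl : k = k' := by omega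
  refine ⟨n, n', e.symm.trans e', ?_⟩
  rw [← height_pred_iterate, ← e, height_pred_iterate, hs]

theorem eq (h : T.CommonAt v w s) (hv : T.height v = s) (hw : T.height w = s) : v = w := by
  obtain ⟨k, n, e, hs⟩ := h
  have h2 := congrArg T.height e
  rw [height_pred_iterate, height_pred_iterate] at h2
  obtain rfl : k = 0 := by omega
  obtain rfl : n = 0 := by omega
  exact e

end CommonAt

theorem commonAt_self (v : T.V) : T.CommonAt v v (T.height v) := ⟨0, 0, rfl, by simp⟩

theorem commonAt_pred (v : T.V) : T.CommonAt v (T.pred v) (T.height v - 1) :=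
  ⟨1, 0, rfl, by simp⟩

theorem exists_commonAt (v w : T.V) : ∃ s, T.CommonAt v w s := by
  obtain ⟨n, k, h⟩ := T.exists_common v w
  exact ⟨_, n, k, h, rfl⟩

theorem commonAt_iterate_pred (n : ℕ) (v : T.V) :
    T.CommonAt v (T.pred^[n] v) (T.height v - n) := ⟨n, 0, rfl, rfl⟩

theorem commonAt_climb (e : Fin q) (n : ℕ) (v : T.V) :
    T.CommonAt v (T.climb e n v) (T.height v) :=
  ⟨0, n, (T.iterate_pred_climb e n v).symm, by simp⟩

variable (T) in
theorem exists_iterate_pred_m (v : T.V) :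
    ∃ k : ℕ, T.pred^[T.m v] T.o = T.pred^[k] v ∧ T.l v = k := by
  have hne : {n : ℕ | ∃ k : ℕ, T.pred^[n] T.o = T.pred^[k] v}.Nonempty := T.exists_common T.o v
  obtain ⟨k, hk⟩ := Nat.sInf_mem hne
  have hm : T.m v = sInf {n : ℕ | ∃ k : ℕ, T.pred^[n] T.o = T.pred^[k] v} := by
    rw [m, meet, dist_iterate_pred]
  exact ⟨k, hm ▸ hk, by rw [l, meet, hk, dist_iterate_pred]⟩

/-- This trades the number `m`, an infimum, for the downward closed relation `CommonAt`, with which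
all later arguments work. -/
theorem commonAt_o_iff {v : T.V} {s : ℤ} : T.CommonAt T.o v s ↔ s ≤ -T.m v := by
  constructor
  · rintro ⟨n, k, h, rfl⟩
    have hm : T.m v = sInf {n : ℕ | ∃ k : ℕ, T.pred^[n] T.o = T.pred^[k] v} := by
      rw [m, meet, dist_iterate_pred]
    have := Nat.sInf_le (show n ∈ {n : ℕ | ∃ k : ℕ, T.pred^[n] T.o = T.pred^[k] v} from ⟨k, h⟩)
    rw [height_o]
    omega
  · obtain ⟨k, h, -⟩ := T.exists_iterate_pred_m v
    exact fun hs => CommonAt.mono ⟨_, k, h, rfl⟩ (by rw [height_o]; omega)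

theorem m_eq_iff {v : T.V} {n : ℕ} :
    T.m v = n ↔ T.CommonAt T.o v (-n) ∧ ¬ T.CommonAt T.o v (-n + 1) := by
  rw [commonAt_o_iff, commonAt_o_iff]
  omega

theorem m_o : T.m T.o = 0 := by
  refine m_eq_iff.2 ⟨(commonAt_self T.o).mono (by simp [height_o]), fun h => ?_⟩
  have := h.le_left
  rw [height_o] at this
  omega

theorem eq_o_of_height_le {v : T.V} (hm : T.m v = 0) (hv : T.height v ≤ 0) : v = T.o := by
  have h : T.CommonAt T.o v 0 := commonAt_o_iff.2 (by simp [hm])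
  exact (h.eq T.height_o (le_antisymm hv h.le_right)).symm

/-- Vertices whose common ancestors with `o` lie at different depths have the higher of them as
their greatest common ancestor. -/
theorem commonAt_iff_of_m_lt {v w : T.V} (h : T.m w < T.m v) {s : ℤ} :
    T.CommonAt v w s ↔ s ≤ -T.m v := by
  have hv {s : ℤ} := commonAt_o_iff (v := v) (s := s)
  have hw {s : ℤ} := commonAt_o_iff (v := w) (s := s)
  constructor
  · intro hs
    by_contra! hlt
    have h1 := (hw.2 (by omega)).trans (hs.mono (show -(T.m v : ℤ) + 1 ≤ s by omega)).symm
    have := hv.1 h1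
    omega
  · exact fun hs => (hv.2 hs).symm.trans (hw.2 (by omega))

theorem commonAt_climb_pred (e : Fin q) (n : ℕ) :
    T.CommonAt T.o (T.climb e n (T.pred^[n] T.o)) (-n) := by
  have h := commonAt_climb e n (T.pred^[n] T.o)
  have h' := commonAt_iterate_pred n T.o
  rw [height_iterate_pred] at h
  rw [height_o, zero_sub] at h'
  exact h'.trans h

theorem m_climb_pred (n : ℕ) : T.m (T.climb 1 n (T.pred^[n] T.o)) = n := by
  refine m_eq_iff.2 ⟨commonAt_climb_pred 1 n, fun h => ?_⟩
  cases n with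
  | zero => simpa [height_o] using h.le_left
  | succ n =>
    have h1 := (commonAt_iterate_pred n T.o).symm
    rw [height_o] at h1
    have h2 := commonAt_climb 1 n (T.child (T.pred^[n + 1] T.o) 1)
    have hh : T.height (T.child (T.pred^[n + 1] T.o) 1) = -n := by
      have := T.height_climb 1 1 (T.pred^[n + 1] T.o)
      rw [height_iterate_pred] at this
      change T.height (T.child (T.pred^[n + 1] T.o) 1) = _ at this
      rw [this]
      push_cast
      ring
    have hn : -((n + 1 : ℕ) : ℤ) + 1 = -n := by push_cast; ring
    rw [hn] at h
    rw [hh] at h2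
    -- A common ancestor one edge higher would make the first edge labelled `1` of the climb an edge
    -- of the descending ray from `o`, against `ray_label`.
    have h3 : T.CommonAt (T.pred^[n] T.o) (T.child (T.pred^[n + 1] T.o) 1) (-n) :=
      ((h1.mono (by omega)).trans h).trans h2.symm
    exact T.ray_label n (h3.eq (T.height_iterate_pred n) hh).symm

theorem not_commonAt_climb_one {v : T.V} :
    ¬ T.CommonAt v (T.climb 0 1 T.o) 1 ∨ ¬ T.CommonAt v (T.climb 1 1 T.o) 1 := by
  by_contra! h
  have h2 := (h.1.symm.trans h.2).eq (by simp [height_climb_o]) (by simp [height_climb_o])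
  have h01 := T.child_injective T.o h2
  have := Nat.AtLeastTwo.prop (n := q)
  rw [Fin.ext_iff, Fin.val_one', Fin.val_zero, Nat.mod_eq_of_lt (by omega)] at h01
  exact zero_ne_one h01

/-! ### Lines through a vertex -/

variable (T) in
/-- The two-sided geodesic through `v`, parametrized by height, that ascends from `v` along edges
labelled `0`. -/
noncomputable def line (v : T.V) (s : ℤ) : T.V :=
  if s ≤ T.height v then T.pred^[(T.height v - s).toNat] v
  else T.climb 0 (s - T.height v).toNat v

theorem height_line (v : T.V) (s : ℤ) : T.height (T.line v s) = s := by
  unfold line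
  split_ifs
  · rw [height_pred_iterate]; omega
  · rw [height_climb]; omega

theorem line_height (v : T.V) : T.line v (T.height v) = v := by simp [line]

theorem pred_line (v : T.V) (s : ℤ) : T.pred (T.line v (s + 1)) = T.line v s := by
  unfold line
  split_ifs with h1 h2 h2
  · rw [← Function.iterate_succ_apply' T.pred]
    congr 2
    omega
  · omega
  · obtain rfl : s = T.height v := by omega
    simp [climb, T.pred_child]
  · obtain ⟨n, hn⟩ : ∃ n : ℕ, s - T.height v = n := ⟨(s - T.height v).toNat, by omega⟩
    have h3 : s + 1 - T.height v = (n + 1 : ℕ) := by push_cast; omega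
    rw [hn, h3, Int.toNat_natCast, Int.toNat_natCast, climb_succ, T.pred_child]

theorem adj_line (v : T.V) {s t : ℤ} (h : t = s + 1 ∨ s = t + 1) :
    T.graph.Adj (T.line v s) (T.line v t) := by
  rw [T.adj_iff]
  rcases h with rfl | rfl
  · exact Or.inr (pred_line v _)
  · exact Or.inl (pred_line v _)

theorem CommonAt.line_eq {v w : T.V} {s : ℤ} (h : T.CommonAt v w s) : T.line v s = T.line w s := by
  have h1 := h.le_left
  have h2 := h.le_right
  obtain ⟨n, k, e, hs⟩ := h
  have h3 := congrArg T.height e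
  rw [height_pred_iterate, height_pred_iterate] at h3
  rw [line, line, if_pos h1, if_pos h2]
  convert e using 2 <;> omega

/-- A path that starts at a vertex adjacent or equal to `v` and visits a common ancestor of its
ends still does so after adding `v` at its beginning. -/
theorem commonAt_cons {v v' w u : T.V} (hv : v = v' ∨ T.graph.Adj v v')
    (hu : T.CommonAt v' w (T.height u)) :
    T.CommonAt v w (T.height u) ∨ T.CommonAt v w (T.height v) := by
  rcases hv with rfl | hv
  · exact Or.inl hu
  rcases (T.adj_iff v v').1 hv with rfl | rfl
  · have h := hu.le_left
    rw [height_pred] at h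
    exact Or.inl (((commonAt_pred v).mono h).trans hu)
  · have h := (commonAt_pred v').symm
    -- In the case of equality the height found is that of `v'` itself; its predecessor `v` is then
    -- the common ancestor that the longer path visits.
    rcases lt_or_eq_of_le hu.le_left with hl | hl
    · exact Or.inl ((h.mono (by omega)).trans hu)
    · right
      rw [height_pred]
      exact h.trans (hu.mono (by omega))

end LabeledTree

/-! ### Projections of paths to heights and to the trees -/

namespace DL

variable {q : ℕ} [q.AtLeastTwo] {T : LabeledTree.{u} q} {d : ℕ}

/-- The heights of the coordinates of a vertex. -/
noncomputable def heights (x : DL T d) (i : Fin d) : ℤ := T.height (proj i x)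

theorem sum_heights (x : DL T d) : ∑ i, heights x i = 0 := x.2

theorem heights_id : heights (id T d) = 0 := funext fun _ => T.height_o

theorem proj_eq_or_adj {x y : DL T d} (h : (graph T d).Adj x y) (k : Fin d) :
    proj k x = proj k y ∨ T.graph.Adj (proj k x) (proj k y) := by
  obtain ⟨i, j, -, hi, hj, hk⟩ := h
  by_cases h1 : k = i
  · exact Or.inr (h1 ▸ hi)
  by_cases h2 : k = j
  · exact Or.inr (h2 ▸ hj)
  · exact Or.inl (hk k h1 h2)

theorem abs_heights_sub_le {x y : DL T d} (p : (graph T d).Walk x y) (i : Fin d) :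
    |heights x i - heights y i| ≤ p.length := by
  induction p with
  | nil => simp
  | @cons x y z h p ih =>
    have h1 : |heights x i - heights y i| ≤ 1 := by
      rw [abs_le]
      rcases proj_eq_or_adj h i with h | h
      · simp [heights, h]
      · have := T.height_sub_of_adj h
        unfold heights
        omega
    rw [SimpleGraph.Walk.length_cons]
    rw [abs_le] at *
    push_cast
    omega

/-- The projection of a path to a tree visits a common ancestor of its ends. -/
theorem exists_commonAt_of_walk {x z : DL T d} (p : (graph T d).Walk x z) (i : Fin d) :
    ∃ y ∈ p.support, T.CommonAt (proj i x) (proj i z) (heights y i) := by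
  induction p with
  | nil => exact ⟨_, by simp, LabeledTree.commonAt_self _⟩
  | @cons x y z h p ih =>
    obtain ⟨w, hw, hc⟩ := ih
    rcases LabeledTree.commonAt_cons (proj_eq_or_adj h i) hc with h1 | h1
    · exact ⟨w, by simp [hw], h1⟩
    · exact ⟨x, by simp, h1⟩

/-! ### Paths of height vectors -/

/-- The graph of height vectors: a step raises one height and lowers another one. -/
def heightGraph (d : ℕ) : SimpleGraph (Fin d → ℤ) where
  Adj a b := ∃ i j : Fin d, i ≠ j ∧ b = a + (Pi.single i 1 - Pi.single j 1)
  symm := ⟨by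
    rintro a b ⟨i, j, hij, rfl⟩
    exact ⟨j, i, hij.symm, by abel⟩⟩
  loopless := ⟨by
    rintro a ⟨i, j, hij, h⟩
    have := congrFun h i
    simp [hij] at this⟩

/-- Adjacency does not say that the two moves have opposite directions; this follows because both
height sums vanish. -/
theorem heightGraph_adj_of_adj {x y : DL T d} (h : (graph T d).Adj x y) :
    (heightGraph d).Adj (heights x) (heights y) := by
  obtain ⟨i, j, hij, hi, hj, hk⟩ := h
  have hk' : ∀ k, k ≠ i → k ≠ j → heights y k = heights x k :=
    fun k h1 h2 => congrArg T.height (hk k h1 h2).symm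
  have hs : ∑ k, (heights y k - heights x k) = 0 := by
    rw [Finset.sum_sub_distrib, sum_heights, sum_heights, sub_self]
  rw [Fintype.sum_eq_add i j hij fun k hk => by rw [hk' k hk.1 hk.2, sub_self]] at hs
  have hi' : heights y i = heights x i + 1 ∨ heights y i = heights x i - 1 :=
    T.height_sub_of_adj hi
  rcases hi' with h | h
  · refine ⟨i, j, hij, funext fun k => ?_⟩
    by_cases h1 : k = i
    · subst h1; simp [hij, h]
    by_cases h2 : k = j
    · subst h2; simp [h1]; omega
    · simp [h1, h2, hk' k h1 h2]
  · refine ⟨j, i, hij.symm, funext fun k => ?_⟩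
    by_cases h1 : k = i
    · subst h1; simp [hij, h]; omega
    by_cases h2 : k = j
    · subst h2; simp [h1]; omega
    · simp [h1, h2, hk' k h1 h2]

variable (T d) in
/-- The projection of a Diestel-Leader graph to height vectors. -/
noncomputable def heightHom : graph T d →g heightGraph d where
  toFun := heights
  map_rel' := heightGraph_adj_of_adj

/-- Guarantees that the triples built when lifting a height walk have height sum zero, hence are
vertices. -/
theorem sum_eq_of_walk {a b : Fin d → ℤ} (p : (heightGraph d).Walk a b) :
    ∑ i, a i = ∑ i, b i := by
  induction p with
  | nil => rfl
  | cons h p ih =>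
    obtain ⟨i, j, -, rfl⟩ := h
    rw [← ih]
    simp [Finset.sum_add_distrib]

/-- A walk of height vectors between the heights of `x` and `z` that is low enough, at some time for
each coordinate, for the ends to have a common ancestor. -/
def IsAdmissible (x z : DL T d) (p : (heightGraph d).Walk (heights x) (heights z)) : Prop :=
  ∀ i, ∃ u ∈ p.support, T.CommonAt (proj i x) (proj i z) (u i)

/-- Admissible walks of height vectors lift to the Diestel-Leader graph. -/
theorem IsAdmissible.exists_walk {x z : DL T d} {p : (heightGraph d).Walk (heights x) (heights z)}
    (hp : IsAdmissible x z p) : ∃ p' : (graph T d).Walk x z, p'.length = p.length := by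
  have hp' : ∀ i, ∃ t ≤ p.length, T.CommonAt (proj i x) (proj i z) (p.getVert t i) := by
    intro i
    obtain ⟨u, hu, hc⟩ := hp i
    obtain ⟨t, rfl, ht⟩ := SimpleGraph.Walk.mem_support_iff_exists_getVert.1 hu
    exact ⟨t, ht, hc⟩
  choose t ht hc using hp'
  -- Tree `i` follows the line through `x_i` up to the time `t i`, when the walk is at the height of
  -- a common ancestor, and afterwards the line through `z_i`.
  set c : ℕ → Fin d → T.V := fun n i =>
    if n ≤ t i then T.line (proj i x) (p.getVert n i) else T.line (proj i z) (p.getVert n i) with hcdef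
  have hch : ∀ n i, T.height (c n i) = p.getVert n i := by
    intro n i
    simp only [hcdef]
    split_ifs <;> exact LabeledTree.height_line _ _
  let w : ℕ → DL T d := fun n => ⟨c n, by
    simp only [hch]
    rw [← sum_eq_of_walk (p.take n), sum_heights]⟩
  -- Both ends of a step lie on one line: at the switching time the two lines meet, by
  -- `CommonAt.line_eq`.
  have hstep : ∀ n i, ∃ v, c n i = T.line v (p.getVert n i) ∧
      c (n + 1) i = T.line v (p.getVert (n + 1) i) := by
    intro n i
    simp only [hcdef]
    rcases lt_trichotomy n (t i) with h | h | h
    · exact ⟨_, if_pos h.le, if_pos h⟩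
    · exact ⟨_, by rw [if_pos h.le, h, (hc i).line_eq], if_neg (by omega)⟩
    · exact ⟨_, if_neg (by omega), if_neg (by omega)⟩
  have hadj : ∀ n < p.length, (graph T d).Adj (w n) (w (n + 1)) := by
    intro n hn
    obtain ⟨i, j, hij, h⟩ := p.adj_getVert_succ hn
    have h' := fun k => congrFun h k
    refine ⟨i, j, hij, ?_, ?_, fun k h1 h2 => ?_⟩
    · obtain ⟨v, h1, h2⟩ := hstep n i
      change T.graph.Adj (c n i) (c (n + 1) i)
      rw [h1, h2]
      exact LabeledTree.adj_line _ (Or.inl (by simp [h', hij]))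
    · obtain ⟨v, h1, h2⟩ := hstep n j
      change T.graph.Adj (c n j) (c (n + 1) j)
      rw [h1, h2]
      exact LabeledTree.adj_line _ (Or.inr (by simp [h', hij.symm]))
    · obtain ⟨v, h3, h4⟩ := hstep n k
      change c n k = c (n + 1) k
      rw [h3, h4]
      simp [h', h1, h2]
  have h0 : w 0 = x := by
    apply Subtype.ext
    funext i
    change c 0 i = proj i x
    simp only [hcdef, zero_le, if_true, SimpleGraph.Walk.getVert_zero]
    exact LabeledTree.line_height _
  have h1 : w p.length = z := by
    apply Subtype.ext
    funext i
    change c p.length i = proj i z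
    simp only [hcdef]
    -- No switch has happened only if `t i` is the final time, and then the two lines agree there.
    split_ifs with h
    · have h2 := (hc i).line_eq
      rw [le_antisymm (ht i) h, SimpleGraph.Walk.getVert_length] at h2
      rw [SimpleGraph.Walk.getVert_length, h2]
      exact LabeledTree.line_height _
    · rw [SimpleGraph.Walk.getVert_length]
      exact LabeledTree.line_height _
  have hw : ∀ n ≤ p.length, ∃ p' : (graph T d).Walk (w 0) (w n), p'.length = n := by
    intro n
    induction n with
    | zero => exact fun _ => ⟨.nil, rfl⟩
    | succ n ih =>
      intro hn
      obtain ⟨p', hp'⟩ := ih (by omega)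
      exact ⟨p'.concat (hadj n hn), by simp [hp']⟩
  have := hw _ le_rfl
  rwa [h0, h1] at this

theorem IsAdmissible.dist_le {x z : DL T d} {p : (heightGraph d).Walk (heights x) (heights z)}
    (hp : IsAdmissible x z p) : (graph T d).dist x z ≤ p.length := by
  obtain ⟨p', h⟩ := hp.exists_walk
  exact h ▸ SimpleGraph.dist_le p'

theorem exists_isAdmissible {x z : DL T d} (p : (graph T d).Walk x z) :
    ∃ p' : (heightGraph d).Walk (heights x) (heights z),
      IsAdmissible x z p' ∧ p'.length = p.length := by
  refine ⟨p.map (heightHom T d), fun i => ?_, p.length_map _⟩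
  obtain ⟨y, hy, hc⟩ := exists_commonAt_of_walk p i
  have hs : (p.map (heightHom T d)).support = p.support.map (heightHom T d) := p.support_map _
  exact ⟨heights y, hs ▸ List.mem_map_of_mem hy, hc⟩

/-! ### Walks of height vectors -/

/-- A straight walk of height vectors. -/
theorem exists_walk_nsmul {i j : Fin d} (hij : i ≠ j) (n : ℕ) (a b : Fin d → ℤ)
    (hb : b = a + n • (Pi.single i 1 - Pi.single j 1)) :
    ∃ p : (heightGraph d).Walk a b, p.length = n := by
  subst hb
  induction n with
  | zero => exact ⟨SimpleGraph.Walk.nil.copy rfl (by simp), by simp⟩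
  | succ n ih =>
    obtain ⟨p, hp⟩ := ih
    have h : (heightGraph d).Adj (a + n • (Pi.single i 1 - Pi.single j 1))
        (a + (n + 1) • (Pi.single i 1 - Pi.single j 1)) :=
      ⟨i, j, hij, by rw [succ_nsmul, add_assoc]⟩
    exact ⟨p.concat h, by simp [hp]⟩

theorem reachable_zsmul {i j : Fin d} (hij : i ≠ j) (n : ℤ) (a : Fin d → ℤ) :
    (heightGraph d).Reachable a (a + n • (Pi.single i 1 - Pi.single j 1)) := by
  obtain ⟨n, rfl | rfl⟩ := n.eq_nat_or_neg
  · obtain ⟨p, -⟩ := exists_walk_nsmul hij n a _ rfl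
    exact ⟨p.copy rfl (by simp)⟩
  · obtain ⟨p, -⟩ := exists_walk_nsmul hij.symm n a _ rfl
    exact ⟨p.copy rfl (by rw [neg_smul, ← smul_neg, neg_sub, natCast_zsmul])⟩

theorem heightGraph_reachable {a b : Fin 3 → ℤ} (h : ∑ i, a i = ∑ i, b i) :
    (heightGraph 3).Reachable a b := by
  have h1 := reachable_zsmul (show (0 : Fin 3) ≠ 2 by decide) (b 0 - a 0) a
  have h2 := reachable_zsmul (show (1 : Fin 3) ≠ 2 by decide) (b 1 - a 1)
    (a + (b 0 - a 0) • (Pi.single 0 1 - Pi.single 2 1))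
  convert h1.trans h2
  rw [Fin.sum_univ_three, Fin.sum_univ_three] at h
  funext i
  fin_cases i
  · simp
  · simp
  · simp; omega

/-! ### Connectedness and the formula for the distance -/

variable (T) in
theorem graph_connected : (graph T 3).Connected := by
  have : Nonempty (DL T 3) := ⟨id T 3⟩
  refine ⟨fun x z => ?_⟩
  have hc := fun i : Fin 3 => T.exists_commonAt (v := proj i x) (w := proj i z)
  choose s hs using hc
  have hx := sum_heights x
  have hz := sum_heights z
  -- For each tree, a vector of sum zero that is low enough in that coordinate; a height walk
  -- through all three of them is admissible.
  have h1 : ∀ i, ∃ a : Fin 3 → ℤ, ∑ k, a k = 0 ∧ a i = s i := by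
    intro i
    refine ⟨Pi.single i (s i) - Pi.single (i + 1) (s i), by simp, ?_⟩
    have : i ≠ i + 1 := by revert i; decide
    simp [this]
  choose a ha has using h1
  obtain ⟨p0⟩ := heightGraph_reachable (hx.trans (ha 0).symm)
  obtain ⟨p1⟩ := heightGraph_reachable ((ha 0).trans (ha 1).symm)
  obtain ⟨p2⟩ := heightGraph_reachable ((ha 1).trans (ha 2).symm)
  obtain ⟨p3⟩ := heightGraph_reachable ((ha 2).trans hz.symm)
  have hp : IsAdmissible x z (p0.append (p1.append (p2.append p3))) := by
    intro i
    refine ⟨a i, ?_, by rw [has]; exact hs i⟩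
    fin_cases i <;> simp [SimpleGraph.Walk.mem_support_append_iff]
  obtain ⟨p', -⟩ := hp.exists_walk
  exact ⟨p'⟩

theorem exists_isAdmissible_dist (x z : DL T 3) :
    ∃ p : (heightGraph 3).Walk (heights x) (heights z),
      IsAdmissible x z p ∧ p.length = (graph T 3).dist x z := by
  obtain ⟨p, hp⟩ := (graph_connected T).exists_walk_length_eq_dist x z
  obtain ⟨p', h1, h2⟩ := exists_isAdmissible p
  exact ⟨p', h1, h2.trans hp⟩

/-- The distance is determined by the heights and the heights of the common ancestors. -/
theorem dist_le_of_commonAt {x z x' z' : DL T 3} (hx : heights x' = heights x)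
    (hz : heights z' = heights z)
    (h : ∀ i s, T.CommonAt (proj i x) (proj i z) s → T.CommonAt (proj i x') (proj i z') s) :
    (graph T 3).dist x' z' ≤ (graph T 3).dist x z := by
  obtain ⟨p, hp, hl⟩ := exists_isAdmissible_dist x z
  have hp' : IsAdmissible x' z' (p.copy hx.symm hz.symm) := by
    intro i
    obtain ⟨u, hu, hc⟩ := hp i
    exact ⟨u, by simpa using hu, h i _ hc⟩
  simpa [hl] using hp'.dist_le

end DL

namespace DL

variable {q : ℕ} [q.AtLeastTwo] {T : LabeledTree.{u} q}

theorem heights_sum_three (x : DL T 3) : heights x 0 + heights x 1 + heights x 2 = 0 := by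
  rw [← Fin.sum_univ_three, sum_heights]

/-! ### Lower bounds for distances -/

/-- Heights change by at most one per step, and the path goes from `x` to `u` and on to `z`. -/
theorem le_length_of_mem_support {x z u : DL T 3} (p : (graph T 3).Walk x z) (hu : u ∈ p.support)
    (i : Fin 3) : heights x i + heights z i - 2 * heights u i ≤ p.length := by
  obtain ⟨r, s, rfl⟩ := SimpleGraph.Walk.mem_support_iff_exists_append.1 hu
  have h1 := abs_le.1 (abs_heights_sub_le r i)
  have h2 := abs_le.1 (abs_heights_sub_le s i)
  rw [SimpleGraph.Walk.length_append]
  push_cast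
  omega

/-- A path that descends in some tree other than the third is not a descending geodesic of the
third tree. -/
theorem lt_length_of_heights_lt {x v : DL T 3} (p : (graph T 3).Walk x v) {i : Fin 3} (hi : i ≠ 2)
    (h : heights v i < heights x i) : heights x 2 - heights v 2 + 1 ≤ p.length := by
  -- If the heights in `T_3` and in tree `i` both drop, the last height rises by their total, hence
  -- by more than the drop in `T_3` alone.
  have h0 := abs_le.1 (abs_heights_sub_le p 0)
  have h1 := abs_le.1 (abs_heights_sub_le p 1)
  have hx := heights_sum_three x
  have hv := heights_sum_three v
  fin_cases i
  · simp only [Fin.zero_eta] at h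
    omega
  · simp only [Fin.mk_one] at h
    omega
  · exact absurd rfl hi

theorem lt_length_of_mem_support {x z u v : DL T 3} (p : (graph T 3).Walk x z) {i : Fin 3}
    (hi : i ≠ 2) (hu : u ∈ p.support) (hv : v ∈ p.support) (hx : heights v i < heights x i)
    (hz : heights v i < heights z i) :
    heights x 2 + heights z 2 - 2 * heights u 2 + 1 ≤ p.length := by
  obtain ⟨r, s, rfl⟩ := SimpleGraph.Walk.mem_support_iff_exists_append.1 hu
  have h1 := abs_le.1 (abs_heights_sub_le r 2)
  have h2 := abs_le.1 (abs_heights_sub_le s 2)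
  rw [SimpleGraph.Walk.length_append]
  -- The low point `v` of tree `i` lies before or after `u`; the extra step is spent between `v` and
  -- the end of the path on its side.
  rcases (SimpleGraph.Walk.mem_support_append_iff _ _).1 hv with hv | hv
  · obtain ⟨r1, r2, rfl⟩ := SimpleGraph.Walk.mem_support_iff_exists_append.1 hv
    have h3 := lt_length_of_heights_lt r1 hi hx
    have h4 := abs_le.1 (abs_heights_sub_le r2 2)
    rw [SimpleGraph.Walk.length_append]
    push_cast
    omega
  · obtain ⟨s1, s2, rfl⟩ := SimpleGraph.Walk.mem_support_iff_exists_append.1 hv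
    have h3 := lt_length_of_heights_lt s2.reverse hi hz
    have h4 := abs_le.1 (abs_heights_sub_le s1 2)
    rw [SimpleGraph.Walk.length_reverse] at h3
    rw [SimpleGraph.Walk.length_append]
    push_cast
    omega

theorem le_dist {x z : DL T 3} {M : ℤ} (i : Fin 3)
    (h : ∀ s, T.CommonAt (proj i x) (proj i z) s → s ≤ M) :
    heights x i + heights z i - 2 * M ≤ (graph T 3).dist x z := by
  obtain ⟨p, hp⟩ := (graph_connected T).exists_walk_length_eq_dist x z
  obtain ⟨u, hu, hc⟩ := exists_commonAt_of_walk p i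
  have := le_length_of_mem_support p hu i
  have := h _ hc
  omega

theorem lt_dist {x z : DL T 3} {M c : ℤ} {i : Fin 3} (hi : i ≠ 2)
    (h : ∀ s, T.CommonAt (proj 2 x) (proj 2 z) s → s ≤ M)
    (h' : ∀ s, T.CommonAt (proj i x) (proj i z) s → s ≤ c)
    (hx : c < heights x i) (hz : c < heights z i) :
    heights x 2 + heights z 2 - 2 * M + 1 ≤ (graph T 3).dist x z := by
  obtain ⟨p, hp⟩ := (graph_connected T).exists_walk_length_eq_dist x z
  obtain ⟨u, hu, hc⟩ := exists_commonAt_of_walk p 2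
  obtain ⟨v, hv, hc'⟩ := exists_commonAt_of_walk p i
  have h1 := h _ hc
  have h2 := h' _ hc'
  have := lt_length_of_mem_support p hi hu hv (by omega) (by omega)
  omega

/-! ### Distances to the base point and to the vertices `ζ` and `ν` -/

theorem proj_zeta_self (i : Fin 3) (k : ℕ) :
    proj i (zeta T i k) = T.climb 1 k (T.pred^[k] T.o) := if_pos rfl

theorem proj_zeta_of_ne {i j : Fin 3} (h : j ≠ i) (k : ℕ) : proj j (zeta T i k) = T.o := if_neg h

theorem heights_zeta (i : Fin 3) (k : ℕ) : heights (zeta T i k) = 0 := by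
  funext j
  unfold heights
  by_cases h : j = i
  · subst h
    rw [proj_zeta_self]
    exact T.height_climb_pred 1 k
  · rw [proj_zeta_of_ne h]
    exact T.height_o

theorem m_proj_zeta (i : Fin 3) (k : ℕ) : T.m (proj i (zeta T i k)) = k := by
  rw [proj_zeta_self, LabeledTree.m_climb_pred]

theorem proj_nu_castSucc (j : Fin 2) (ε : Fin q) :
    proj j.castSucc (nu T j ε 1) = T.climb ε 1 T.o := if_pos rfl

theorem proj_nu_two (j : Fin 2) (ε : Fin q) : proj 2 (nu T j ε 1) = T.pred T.o := by
  fin_cases j <;> rfl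

theorem proj_nu_of_ne {j : Fin 2} {i : Fin 3} (h : i ≠ j.castSucc) (h' : i ≠ 2) (ε : Fin q) :
    proj i (nu T j ε 1) = T.o := (if_neg h).trans (if_neg h')

theorem castSucc_ne_two (j : Fin 2) : j.castSucc ≠ 2 := by revert j; decide

theorem heights_nu (j : Fin 2) (ε : Fin q) :
    heights (nu T j ε 1) = Pi.single j.castSucc 1 - Pi.single 2 1 := by
  funext i
  unfold heights
  by_cases h : i = j.castSucc
  · subst h
    rw [proj_nu_castSucc, T.height_climb_o]
    simp [castSucc_ne_two]
  by_cases h' : i = 2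
  · subst h'
    rw [proj_nu_two, T.height_pred, T.height_o]
    simp [h]
  · rw [proj_nu_of_ne h h', T.height_o]
    simp [h, h']

/-- Both targets have heights zero, and every common ancestor of `x_i` with `o` is at depth at least
`m ≥ k`, hence also lies below the `i`-th coordinate of `ζ^i_k`. -/
theorem dist_zeta_le {x : DL T 3} {i : Fin 3} {k : ℕ} (h : k ≤ T.m (proj i x)) :
    (graph T 3).dist x (zeta T i k) ≤ (graph T 3).dist x (id T 3) := by
  refine dist_le_of_commonAt rfl (by rw [heights_zeta, heights_id]) fun j s hs => ?_
  change T.CommonAt (proj j x) T.o s at hs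
  by_cases hj : j = i
  · subst hj
    refine hs.trans (LabeledTree.commonAt_o_iff.2 ?_)
    have := LabeledTree.commonAt_o_iff.1 hs.symm
    rw [m_proj_zeta]
    omega
  · rwa [proj_zeta_of_ne hj]

theorem dist_id_le {x : DL T 3} (h0 : T.m (proj 0 x) = 0) (h1 : T.m (proj 1 x) = 0) :
    ((graph T 3).dist x (id T 3) : ℤ) ≤ 2 * T.m (proj 2 x) + heights x 2 := by
  have hs := heights_sum_three x
  have e0 : heights x 0 = T.l (proj 0 x) - T.m (proj 0 x) := rfl
  have e1 : heights x 1 = T.l (proj 1 x) - T.m (proj 1 x) := rfl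
  have e2 : heights x 2 = T.l (proj 2 x) - T.m (proj 2 x) := rfl
  -- Descend in `T_3` to the common ancestor with `o` while ascending in `T_1`, then let `T_3`
  -- ascend against the descents in `T_2` and in `T_1`. The length `l_1 + l_2 + 2 l_3` equals `2 m_3
  -- + h_3`, because `l_1 + l_2 + l_3 = m_3`.
  obtain ⟨p, hp⟩ := exists_walk_nsmul (show (0 : Fin 3) ≠ 2 by decide) (T.l (proj 2 x))
    (heights x) _ rfl
  obtain ⟨p', hp'⟩ := exists_walk_nsmul (show (2 : Fin 3) ≠ 1 by decide) (T.l (proj 1 x))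
    (heights x + T.l (proj 2 x) • (Pi.single 0 1 - Pi.single 2 1)) _ rfl
  obtain ⟨p'', hp''⟩ := exists_walk_nsmul (show (2 : Fin 3) ≠ 0 by decide)
    (T.l (proj 0 x) + T.l (proj 2 x))
    (heights x + T.l (proj 2 x) • (Pi.single 0 1 - Pi.single 2 1) +
      T.l (proj 1 x) • (Pi.single 2 1 - Pi.single 1 1)) (heights (id T 3)) (by
    rw [heights_id]
    funext i
    fin_cases i <;> simp <;> omega)
  have ha : IsAdmissible x (id T 3) (p.append (p'.append p'')) := by
    intro i
    have key : ∀ s ≤ -(T.m (proj i x) : ℤ), T.CommonAt (proj i x) (proj i (id T 3)) s :=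
      fun s hs => (LabeledTree.commonAt_o_iff.2 hs).symm
    fin_cases i
    · refine ⟨heights (id T 3), by simp, key _ ?_⟩
      simp [heights_id, h0]
    · refine ⟨heights (id T 3), by simp, key _ ?_⟩
      simp [heights_id, h1]
    · refine ⟨heights x + T.l (proj 2 x) • (Pi.single 0 1 - Pi.single 2 1),
        (SimpleGraph.Walk.mem_support_append_iff _ _).2 (Or.inl p.end_mem_support), key _ ?_⟩
      simp
      omega
  have := ha.dist_le
  rw [SimpleGraph.Walk.length_append, SimpleGraph.Walk.length_append, hp, hp', hp''] at this
  omega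

theorem dist_id_of_proj_eq {x : DL T 3} (h0 : proj 0 x = T.o) (h1 : proj 1 x = T.o) :
    (graph T 3).dist x (id T 3) = 2 * T.m (proj 2 x) := by
  have hs := heights_sum_three x
  have e0 : heights x 0 = 0 := by rw [heights, h0, T.height_o]
  have e1 : heights x 1 = 0 := by rw [heights, h1, T.height_o]
  have hl := dist_id_le (x := x) (by rw [h0, LabeledTree.m_o]) (by rw [h1, LabeledTree.m_o])
  have hu := le_dist (x := x) (z := id T 3) 2
    fun s h => LabeledTree.commonAt_o_iff.1 (LabeledTree.CommonAt.symm h)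
  rw [heights_id, Pi.zero_apply] at hu
  omega

theorem dist_zeta_two_id (n : ℕ) : (graph T 3).dist (zeta T 2 n) (id T 3) = 2 * n := by
  rw [dist_id_of_proj_eq (proj_zeta_of_ne (by decide) n) (proj_zeta_of_ne (by decide) n),
    m_proj_zeta]

theorem le_dist_zeta_two {x : DL T 3} (h0 : proj 0 x = T.o) (h1 : proj 1 x = T.o) {k : ℕ}
    (hk : T.m (proj 2 x) < k) : 2 * k ≤ (graph T 3).dist x (zeta T 2 k) := by
  have hs := heights_sum_three x
  have e0 : heights x 0 = 0 := by rw [heights, h0, T.height_o]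
  have e1 : heights x 1 = 0 := by rw [heights, h1, T.height_o]
  have := le_dist (x := x) (z := zeta T 2 k) (M := -k) 2 fun s h => by
    have := (LabeledTree.commonAt_iff_of_m_lt (by rwa [m_proj_zeta])).1 h.symm
    rwa [m_proj_zeta] at this
  rw [heights_zeta, Pi.zero_apply] at this
  omega

/-- The path must reach depth `n` in `T_3` and depth `1` in tree `i`, where both of its ends have
height `0`. -/
theorem lt_dist_zeta_two_zeta {i : Fin 3} (hi : i ≠ 2) (n : ℕ) :
    2 * n + 1 ≤ (graph T 3).dist (zeta T 2 n) (zeta T i 1) := by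
  have := lt_dist (x := zeta T 2 n) (z := zeta T i 1) (M := -n) (c := -1) hi
    (fun s h => by
      rw [proj_zeta_of_ne hi.symm] at h
      have := LabeledTree.commonAt_o_iff.1 h.symm
      rwa [m_proj_zeta] at this)
    (fun s h => by
      rw [proj_zeta_of_ne hi] at h
      have := LabeledTree.commonAt_o_iff.1 h
      rwa [m_proj_zeta] at this)
    (by simp [heights_zeta]) (by simp [heights_zeta])
  simp only [heights_zeta, Pi.zero_apply] at this
  omega

/-- Go down `n` in `T_3` against an ascent in `T_j`, then return only `n - 1` steps, since `ν` has
heights `1` and `-1` there. The ascent in `T_j` may begin with the edge labelled `ε`. -/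
theorem dist_zeta_two_nu_lt {n : ℕ} (hn : 1 ≤ n) (j : Fin 2) (ε : Fin q) :
    (graph T 3).dist (zeta T 2 n) (nu T j ε 1) < 2 * n := by
  have hj := castSucc_ne_two j
  obtain ⟨p, hp⟩ := exists_walk_nsmul hj n (heights (zeta T 2 n)) _ rfl
  obtain ⟨p', hp'⟩ := exists_walk_nsmul hj.symm (n - 1)
    (heights (zeta T 2 n) + n • (Pi.single j.castSucc 1 - Pi.single 2 1)) (heights (nu T j ε 1)) (by
      obtain ⟨k, rfl⟩ : ∃ k, n = k + 1 := ⟨n - 1, by omega⟩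
      rw [heights_nu, heights_zeta, zero_add, Nat.add_sub_cancel, succ_nsmul,
        ← neg_sub (Pi.single j.castSucc 1) (Pi.single 2 1), smul_neg]
      abel)
  have ha : IsAdmissible (zeta T 2 n) (nu T j ε 1) (p.append p') := by
    intro i
    by_cases h2 : i = 2
    · subst h2
      refine ⟨_, (SimpleGraph.Walk.mem_support_append_iff _ _).2 (Or.inl p.end_mem_support), ?_⟩
      have h3 : T.CommonAt T.o (T.pred T.o) (-1) := by
        simpa [T.height_o] using LabeledTree.commonAt_pred T.o
      rw [proj_nu_two]
      have h4 : T.CommonAt T.o (proj 2 (zeta T 2 n)) (-n) :=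
        LabeledTree.commonAt_o_iff.2 (by rw [m_proj_zeta])
      convert h4.symm.trans (h3.mono (by omega)) using 1
      simp [heights_zeta, hj.symm]
    · refine ⟨heights (zeta T 2 n), by simp, ?_⟩
      rw [heights_zeta, Pi.zero_apply, proj_zeta_of_ne h2]
      by_cases h : i = j.castSucc
      · subst h
        rw [proj_nu_castSucc]
        simpa [T.height_o] using LabeledTree.commonAt_climb ε 1 T.o
      · rw [proj_nu_of_ne h h2]
        simpa [T.height_o] using LabeledTree.commonAt_self T.o
  have := ha.dist_le
  rw [SimpleGraph.Walk.length_append, hp, hp'] at this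
  omega

/-- Both `x_j` and the `j`-th coordinate of `ν` have positive height but no common ancestor above
height `0`. The extra step for descending in `T_j` compensates for the height `-1` of `ν` in `T_3`.
-/
theorem le_dist_nu {x : DL T 3} {j : Fin 2} {ε : Fin q} (hx : 1 ≤ heights x j.castSucc)
    (h : ¬ T.CommonAt (proj j.castSucc x) (T.climb ε 1 T.o) 1) :
    2 * T.m (proj 2 x) + heights x 2 ≤ (graph T 3).dist x (nu T j ε 1) := by
  have hj := castSucc_ne_two j
  have := lt_dist (x := x) (z := nu T j ε 1) (M := -T.m (proj 2 x)) (c := 0) hj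
    (fun s hs => by
      rw [proj_nu_two] at hs
      have h1 := hs.le_right
      rw [T.height_pred] at h1
      exact LabeledTree.commonAt_o_iff.1 (((LabeledTree.commonAt_pred T.o).mono h1).trans hs.symm))
    (fun s hs => by
      rw [proj_nu_castSucc] at hs
      by_contra! h1
      exact h (hs.mono (by omega)))
    (by omega) (by simp [heights_nu, hj])
  simp only [heights_nu, Pi.sub_apply, Pi.single_eq_same, Pi.single_eq_of_ne hj.symm] at this
  omega

/-- A vertex with a nontrivial projection to one of the first two trees is separated from the limit
of the vertices `ζ^3_n` by a test point. -/
theorem exists_test {x : DL T 3} (hx : proj 0 x ≠ T.o ∨ proj 1 x ≠ T.o) :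
    (∃ i : Fin 3, i ≠ 2 ∧ (graph T 3).dist x (zeta T i 1) ≤ (graph T 3).dist x (id T 3)) ∨
    ∃ (j : Fin 2) (ε : Fin q), (ε = 0 ∨ ε = 1) ∧
      (graph T 3).dist x (id T 3) ≤ (graph T 3).dist x (nu T j ε 1) := by
  by_cases h0 : 1 ≤ T.m (proj 0 x)
  · exact Or.inl ⟨0, by decide, dist_zeta_le h0⟩
  by_cases h1 : 1 ≤ T.m (proj 1 x)
  · exact Or.inl ⟨1, by decide, dist_zeta_le h1⟩
  right
  have h0' : T.m (proj 0 x) = 0 := by omega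
  have h1' : T.m (proj 1 x) = 0 := by omega
  have hd := dist_id_le h0' h1'
  -- With `m = 0`, only `o` itself has height at most `0`, so the nontrivial coordinate has positive
  -- height.
  obtain ⟨j, hj⟩ : ∃ j : Fin 2, 1 ≤ heights x j.castSucc := by
    rcases hx with h | h
    · exact ⟨0, by by_contra! hlt; exact h (LabeledTree.eq_o_of_height_le h0' (by
        change heights x 0 < 1 at hlt; unfold heights at hlt; omega))⟩
    · exact ⟨1, by by_contra! hlt; exact h (LabeledTree.eq_o_of_height_le h1' (by
        change heights x 1 < 1 at hlt; unfold heights at hlt; omega))⟩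
  rcases T.not_commonAt_climb_one (v := proj j.castSucc x) with h | h
  · have := le_dist_nu hj h
    exact ⟨j, 0, Or.inl rfl, by omega⟩
  · have := le_dist_nu hj h
    exact ⟨j, 1, Or.inr rfl, by omega⟩

/-! ### Convergence of the vertices `ζ^3_n` -/

theorem dist_zeta_two_succ_le {z : DL T 3} {n : ℕ} (h : T.m (proj 2 z) < n) :
    (graph T 3).dist (zeta T 2 (n + 1)) z ≤ (graph T 3).dist (zeta T 2 n) z + 2 := by
  obtain ⟨p, hp, hl⟩ := exists_isAdmissible_dist (zeta T 2 n) z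
  obtain ⟨u, hu, hc⟩ := hp 2
  obtain ⟨r, s, rfl⟩ := SimpleGraph.Walk.mem_support_iff_exists_append.1 hu
  rw [LabeledTree.commonAt_iff_of_m_lt (by rwa [m_proj_zeta]), m_proj_zeta] at hc
  -- At `u` the height in `T_3` is at most `-n`; the detour lowers it once more and returns, at the
  -- cost of two steps.
  have hadj : (heightGraph 3).Adj u (u + (Pi.single 0 1 - Pi.single 2 1)) :=
    ⟨0, 2, by decide, rfl⟩
  have ha : IsAdmissible (zeta T 2 (n + 1)) z
      ((r.append ((SimpleGraph.Walk.cons hadj (SimpleGraph.Walk.cons hadj.symm s)))).copy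
        (by rw [heights_zeta, heights_zeta]) rfl) := by
    intro i
    by_cases hi : i = 2
    · subst hi
      refine ⟨u + (Pi.single 0 1 - Pi.single 2 1), by simp, ?_⟩
      rw [LabeledTree.commonAt_iff_of_m_lt (by rw [m_proj_zeta]; omega), m_proj_zeta]
      simp
      omega
    · obtain ⟨v, hv, hc⟩ := hp i
      rw [proj_zeta_of_ne hi] at hc ⊢
      refine ⟨v, ?_, hc⟩
      rw [SimpleGraph.Walk.mem_support_append_iff] at hv
      rw [SimpleGraph.Walk.support_copy, SimpleGraph.Walk.mem_support_append_iff]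
      simp only [SimpleGraph.Walk.support_cons, List.mem_cons]
      tauto
  have := ha.dist_le
  simp only [SimpleGraph.Walk.length_copy, SimpleGraph.Walk.length_append,
    SimpleGraph.Walk.length_cons] at this hl
  omega

variable (T) in
theorem exists_eventually_eq (z : DL T 3) : ∃ c : ℤ, ∀ᶠ n in atTop,
    ((graph T 3).dist (zeta T 2 n) z : ℤ) - (graph T 3).dist (zeta T 2 n) (id T 3) = c := by
  -- By the triangle inequality this natural subtraction never truncates, so `g` is the renormalized
  -- distance shifted to be nonnegative.
  set g : ℕ → ℕ := fun n => (graph T 3).dist (zeta T 2 n) z + (graph T 3).dist z (id T 3) - 2 * n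
    with hg
  have htri : ∀ n, 2 * n ≤ (graph T 3).dist (zeta T 2 n) z + (graph T 3).dist z (id T 3) := by
    intro n
    rw [← dist_zeta_two_id (T := T)]
    exact (graph_connected T).dist_triangle
  have hanti : ∀ n k, T.m (proj 2 z) < n → g (n + k) ≤ g n := by
    intro n k hn
    induction k with
    | zero => rfl
    | succ k ih =>
      have := dist_zeta_two_succ_le (z := z) (n := n + k) (by omega)
      simp only [hg] at ih ⊢
      rw [← add_assoc]
      omega
  have hne : {r | ∃ n, T.m (proj 2 z) < n ∧ g n = r}.Nonempty := ⟨_, _, Nat.lt_succ_self _, rfl⟩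
  obtain ⟨N, hN, hr⟩ := Nat.sInf_mem hne
  refine ⟨g N - (graph T 3).dist z (id T 3), eventually_atTop.2 ⟨N, fun n hn => ?_⟩⟩
  have h1 : g N ≤ g n := hr ▸ Nat.sInf_le ⟨n, by omega, rfl⟩
  have h2 := hanti N (n - N) hN
  rw [Nat.add_sub_cancel' hn] at h2
  have h3 := htri n
  rw [dist_zeta_two_id, le_antisymm h1 h2]
  simp only [hg]
  omega

/-- Far from `z`, the distance to `z` of a vertex with trivial projections to the first two trees
depends only on the depth of its third coordinate. -/
theorem dist_eq_dist_zeta_two {x z : DL T 3} (h0 : proj 0 x = T.o) (h1 : proj 1 x = T.o)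
    (h : T.m (proj 2 z) < T.m (proj 2 x)) :
    (graph T 3).dist x z = (graph T 3).dist (zeta T 2 (T.m (proj 2 x))) z := by
  have hs := heights_sum_three x
  have e0 : heights x 0 = 0 := by rw [heights, h0, T.height_o]
  have e1 : heights x 1 = 0 := by rw [heights, h1, T.height_o]
  have hh : heights x = heights (zeta T 2 (T.m (proj 2 x))) := by
    rw [heights_zeta]
    funext i
    fin_cases i
    · exact e0
    · exact e1
    · change heights x 2 = 0
      omega
  have key : ∀ i s, T.CommonAt (proj i x) (proj i z) s ↔
      T.CommonAt (proj i (zeta T 2 (T.m (proj 2 x)))) (proj i z) s := by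
    intro i s
    by_cases hi : i = 2
    · subst hi
      rw [LabeledTree.commonAt_iff_of_m_lt h,
        LabeledTree.commonAt_iff_of_m_lt (by rwa [m_proj_zeta]), m_proj_zeta]
    · rw [proj_zeta_of_ne hi]
      have hi' : proj i x = T.o := by
        fin_cases i
        · exact h0
        · exact h1
        · exact absurd rfl hi
      rw [hi']
  exact le_antisymm (dist_le_of_commonAt hh rfl fun i s => (key i s).2)
    (dist_le_of_commonAt hh.symm rfl fun i s => (key i s).1)

end DL

/-! ### Pointwise convergence in the horofunction compactification -/

section Horofunction

variable {X : Type u} [TopologicalSpace X] [DiscreteTopology X] {G : SimpleGraph X} {x₀ : X}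

/-- On a discrete space the compact-open topology is that of pointwise convergence. -/
theorem HoroCompactification.tendsto_iff_eval {ι : Type*} {l : Filter ι}
    {F : ι → HoroCompactification G x₀} {β : HoroCompactification G x₀} :
    Tendsto F l (𝓝 β) ↔ ∀ z, Tendsto (fun n => (F n).eval z) l (𝓝 (β.eval z)) := by
  rw [tendsto_subtype_rng, tendsto_subtype_rng,
    (ContinuousMap.isHomeomorph_coe (X := X) (Y := ℝ)).isInducing.tendsto_nhds_iff, tendsto_pi_nhds]
  rfl

theorem horoEmbed_eval (x z : X) :
    (horoEmbed G x₀ x).eval z = (((G.dist x z : ℤ) - (G.dist x x₀ : ℤ) : ℤ) : ℝ) := by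
  push_cast
  rfl

theorem HoroCompactification.exists_of_eventually_eq {x : ℕ → X} {c : X → ℤ}
    (h : ∀ z, ∀ᶠ n in atTop, (G.dist (x n) z : ℤ) - (G.dist (x n) x₀ : ℤ) = c z) :
    ∃ β : HoroCompactification G x₀, ∀ z, β.eval z = c z := by
  have h0 : (c x₀ : ℝ) = 0 := by
    obtain ⟨n, hn⟩ := (h x₀).exists
    rw [← hn, sub_self, Int.cast_zero]
  let f : BasedMap x₀ := ⟨⟨fun z => (c z : ℝ), continuous_of_discreteTopology⟩, h0⟩
  refine ⟨⟨f, mem_closure_of_tendsto (b := atTop) (f := fun n => horoMap G x₀ (x n)) ?_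
    (Eventually.of_forall fun n => Set.mem_range_self _)⟩, fun _ => rfl⟩
  rw [tendsto_subtype_rng,
    (ContinuousMap.isHomeomorph_coe (X := X) (Y := ℝ)).isInducing.tendsto_nhds_iff, tendsto_pi_nhds]
  intro z
  refine tendsto_const_nhds.congr' ?_
  filter_upwards [h z] with n hn
  exact (congrArg _ hn.symm).trans (horoEmbed_eval _ _).symm

/-- Horofunctions take integer values, so vertices converge if and only if every value is
eventually the limit value. -/
theorem tendsto_horoEmbed_iff {b : ℕ → X} {β : HoroCompactification G x₀} {c : X → ℤ}
    (hβ : ∀ z, β.eval z = c z) :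
    Tendsto (fun n => horoEmbed G x₀ (b n)) atTop (𝓝 β) ↔
      ∀ z, ∀ᶠ n in atTop, (G.dist (b n) z : ℤ) - (G.dist (b n) x₀ : ℤ) = c z := by
  rw [HoroCompactification.tendsto_iff_eval]
  refine forall_congr' fun z => ?_
  simp only [horoEmbed_eval, hβ]
  have := Int.isClosedEmbedding_coe_real.isInducing.tendsto_nhds_iff
    (f := fun n => (G.dist (b n) z : ℤ) - (G.dist (b n) x₀ : ℤ)) (l := atTop) (y := c z)
  rw [nhds_discrete, tendsto_pure] at this
  exact this.symm

end Horofunction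

/-! ### The horofunction and the sequences converging to it -/

theorem mainTheorem4 (q : ℕ) [q.AtLeastTwo] (T : LabeledTree.{u} q) :
    ∃ β : HoroCompactification (DL.graph T 3) (DL.id T 3),
      IsHorofunctionOf β (DL.betaSeq T) ∧
      (∀ b : ℕ → DL T 3,
        Tendsto (fun n => horoEmbed (DL.graph T 3) (DL.id T 3) (b n)) atTop (𝓝 β) ↔
          (∃ N : ℕ, ∀ n ≥ N, DL.proj 0 (b n) = T.o ∧ DL.proj 1 (b n) = T.o) ∧
            Tendsto (fun n => T.m (DL.proj 2 (b n))) atTop atTop) ∧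
      (∀ x : DL T 3, DL.proj 0 x ≠ T.o ∨ DL.proj 1 x ≠ T.o →
        ∃ f ∈ DL.testPoints T,
          (horoEmbed (DL.graph T 3) (DL.id T 3) x).eval f ≠ β.eval f) := by
  choose c hc using DL.exists_eventually_eq T
  obtain ⟨β, hβ⟩ := HoroCompactification.exists_of_eventually_eq hc
  have hzeta : ∀ i : Fin 3, i ≠ 2 → 1 ≤ c (DL.zeta T i 1) := by
    intro i hi
    obtain ⟨n, hn⟩ := (hc (DL.zeta T i 1)).exists
    have h1 := DL.lt_dist_zeta_two_zeta (T := T) hi n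
    rw [DL.dist_zeta_two_id] at hn
    omega
  have hnu : ∀ (j : Fin 2) (ε : Fin q), c (DL.nu T j ε 1) < 0 := by
    intro j ε
    obtain ⟨n, hn, hn1⟩ := ((hc (DL.nu T j ε 1)).and (eventually_ge_atTop 1)).exists
    have h1 := DL.dist_zeta_two_nu_lt (T := T) hn1 j ε
    rw [DL.dist_zeta_two_id] at hn
    omega
  have hzeta2 : ∀ k : ℕ, c (DL.zeta T 2 k) ≤ 0 := by
    intro k
    obtain ⟨n, hn, hn1⟩ := ((hc (DL.zeta T 2 k)).and (eventually_ge_atTop k)).exists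
    have h1 := DL.dist_zeta_le (x := DL.zeta T 2 n) (i := 2) (k := k)
      (by rwa [DL.m_proj_zeta])
    omega
  have htest : ∀ x : DL T 3, DL.proj 0 x ≠ T.o ∨ DL.proj 1 x ≠ T.o →
      ∃ f ∈ DL.testPoints T, (horoEmbed (DL.graph T 3) (DL.id T 3) x).eval f ≠ β.eval f := by
    intro x hx
    simp only [horoEmbed_eval, hβ, ne_eq, Int.cast_inj]
    rcases DL.exists_test hx with ⟨i, hi, h⟩ | ⟨j, ε, hε, h⟩
    · refine ⟨DL.zeta T i 1, ?_, ?_⟩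
      · fin_cases i
        · simp [DL.testPoints]
        · simp [DL.testPoints]
        · exact absurd rfl hi
      · have := hzeta i hi
        omega
    · refine ⟨DL.nu T j ε 1, ?_, ?_⟩
      · rcases hε with rfl | rfl <;> fin_cases j <;> simp [DL.testPoints]
      · have := hnu j ε
        omega
  -- If `k > m_3(x)`, then `d(x, ζ^3_k) ≥ 2k > 2 m_3(x) = d(x, id)`, a positive value where `β ≤ 0`.
  have hm : ∀ (x : DL T 3) (k : ℕ), DL.proj 0 x = T.o → DL.proj 1 x = T.o →
      ((DL.graph T 3).dist x (DL.zeta T 2 k) : ℤ) - ((DL.graph T 3).dist x (DL.id T 3) : ℤ) =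
        c (DL.zeta T 2 k) → k ≤ T.m (DL.proj 2 x) := by
    intro x k h0 h1 h
    by_contra! hlt
    have h2 := DL.le_dist_zeta_two h0 h1 hlt
    have h3 := DL.dist_id_of_proj_eq h0 h1
    have h4 := hzeta2 k
    omega
  refine ⟨β, ⟨?_, fun z => ?_⟩, fun b => ?_, htest⟩
  · rintro ⟨x, rfl⟩
    have hx : DL.proj 0 x = T.o ∧ DL.proj 1 x = T.o := by
      by_contra hx
      obtain ⟨f, -, hf⟩ := htest x (not_and_or.1 hx)
      exact hf rfl
    -- A vertex inducing `β` would pass the test at every `ζ^3_k`, in particular one deeper than its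
    -- own third coordinate.
    have h := hβ (DL.zeta T 2 (T.m (DL.proj 2 x) + 1))
    rw [horoEmbed_eval, Int.cast_inj] at h
    have := hm x _ hx.1 hx.2 h
    omega
  · exact HoroCompactification.tendsto_iff_eval.1 ((tendsto_horoEmbed_iff hβ).2 hc) z
  · rw [tendsto_horoEmbed_iff hβ]
    constructor
    · intro h
      have htriv : ∀ᶠ n in atTop, DL.proj 0 (b n) = T.o ∧ DL.proj 1 (b n) = T.o := by
        have hfin : (DL.testPoints T).Finite := by simp [DL.testPoints]
        -- Finiteness of the test set makes agreement with `β` on all of it hold on one common tail.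
        filter_upwards [(hfin.eventually_all).2 fun f _ => h f] with n hn
        by_contra hx
        obtain ⟨f, hf, hne⟩ := htest (b n) (not_and_or.1 hx)
        rw [horoEmbed_eval, hβ, hn f hf] at hne
        exact hne rfl
      refine ⟨eventually_atTop.1 htriv, tendsto_atTop.2 fun k => ?_⟩
      filter_upwards [htriv, h (DL.zeta T 2 k)] with n hn hk
      exact hm _ k hn.1 hn.2 hk
    · rintro ⟨htriv, hlim⟩ z
      filter_upwards [eventually_atTop.2 htriv, hlim.eventually (hc z),
        hlim.eventually_gt_atTop (T.m (DL.proj 2 z))] with n hn hcn hz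
      rw [DL.dist_eq_dist_zeta_two hn.1 hn.2 hz, DL.dist_id_of_proj_eq hn.1 hn.2, ← hcn,
        DL.dist_zeta_two_id]
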